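/- Let $\mathbb{N}=\{0,1,2,\dots\}$ and let $\mathbb{B}=\mathbb{N}\cup\{{}^{\blacktriangleright}d : d\in\mathbb{N}\}$, where a number $k\in\mathbb{N}$ is said to satisfy the constraint $d$ if $k=d$, and to satisfy the constraint ${}^{\blacktriangleright}d$ if $k\ge d$. An $\ell$-type bipartite graph is a tuple $G=(U,V,E_1,\dots,E_\ell)$ in which $U,V$ are finite sets (the two sides) and $E_1,\dots,E_\ell$ are pairwise disjoint subsets of $U\times V$; it is not required that $E_1\cup\dots\cup E_\ell=U\times V$. For a vertex $w\in U\cup V$, let $\deg_{E_i}(w)$ be the number of edges in $E_i$ that are incident to $w$. For $C\in\mathbb{B}^{\ell\times m}$ and $D\in\mathbb{B}^{\ell\times n}$, such a graph $G$ is called $(C,D)$-biregular of size $(\bar M,\bar N)\in\mathbb{N}^m\times\mathbb{N}^n$ if there are partitions $U=U_1\cup\dots\cup U_m$ and $V=V_1\cup\dots\cup V_n$ into pairwise disjoint, possibly empty, sets with $|U_j|=M_j$ for $1\le j\le m$ and $|V_k|=N_k$ for $1\le k\le n$, such that for every $1\le i\le\ell$: for all $j$ and all $u\in U_j$ the number $\deg_{E_i}(u)$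 satisfies the constraint $C_{i,j}$, and for all $k$ and all $v\in V_k$ the number $\deg_{E_i}(v)$ satisfies the constraint $D_{i,k}$. A Presburger formula is a first-order formula over the structure $(\mathbb{N},0,1,+)$ (the order $\le$ is definable in it). Theorem. For all $\ell,m,n\in\mathbb{N}$ and all matrices $C\in\mathbb{B}^{\ell\times m}$ and $D\in\mathbb{B}^{\ell\times n}$ there is a Presburger formula $\mathsf{BiREG}_{C,D}(\bar X,\bar Y)$ with free variables among $\bar X=(X_1,\dots,X_m)$ and $\bar Y=(Y_1,\dots,Y_n)$ such that for all $\bar M\in\mathbb{N}^m$ and $\bar N\in\mathbb{N}^n$: there exists an $\ell$-type $(C,D)$-biregular graph of size $(\bar M,\bar N)$ if and only if $\mathsf{BiREG}_{C,D}(\bar M,\bar N)$ holds. -/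

import Mathlib

/-- The set `𝔹 = ℕ ∪ ▸ℕ` of degree constraints: `exactly d` stands for `d`,
`atLeast d` stands for `▸d`. -/
inductive DegBound : Type
  | exactly (d : ℕ) : DegBound
  | atLeast (d : ℕ) : DegBound

namespace DegBound

/-- `b.Holds k` means that the number `k` satisfies the degree constraint `b`. -/
def Holds : DegBound → ℕ → Prop
  | exactly d, k => k = d
  | atLeast d, k => d ≤ k

end DegBound

/-- An `ℓ`-type bipartite graph with the two sides `U` and `V`: `ℓ` pairwise disjoint
subsets of `U × V`. -/
structure TypedBipartiteGraph (ℓ : ℕ) (U V : Type) where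
  edges : Fin ℓ → Set (U × V)
  pairwise_disjoint : ∀ i j : Fin ℓ, i ≠ j → Disjoint (edges i) (edges j)

namespace TypedBipartiteGraph

variable {ℓ m n : ℕ} {U V : Type}

/-- The number of `E_i`-edges at a vertex `u` of the left side. -/
noncomputable def degLeft (G : TypedBipartiteGraph ℓ U V) (i : Fin ℓ) (u : U) : ℕ :=
  {v : V | (u, v) ∈ G.edges i}.ncard

/-- The number of `E_i`-edges at a vertex `v` of the right side. -/
noncomputable def degRight (G : TypedBipartiteGraph ℓ U V) (i : Fin ℓ) (v : V) : ℕ :=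
  {u : U | (u, v) ∈ G.edges i}.ncard

/-- The partitions `U = U_1 ∪ ⋯ ∪ U_m` and `V = V_1 ∪ ⋯ ∪ V_n` (blocks may be empty), given by
the maps `p`, `q` that send each vertex to the index of its block, witness that `G` is
`(C, D)`-biregular. -/
structure IsBiregularWitness (G : TypedBipartiteGraph ℓ U V)
    (C : Matrix (Fin ℓ) (Fin m) DegBound) (D : Matrix (Fin ℓ) (Fin n) DegBound)
    (p : U → Fin m) (q : V → Fin n) : Prop where
  left : ∀ (i : Fin ℓ) (u : U), (C i (p u)).Holds (G.degLeft i u)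
  right : ∀ (i : Fin ℓ) (v : V), (D i (q v)).Holds (G.degRight i v)

/-- `G` is a `(C, D)`-biregular graph of size `(M, N)`: some witnessing partitions have
`|U_j| = M_j` for all `j` and `|V_k| = N_k` for all `k`. -/
def IsBiregularOfSize (G : TypedBipartiteGraph ℓ U V)
    (C : Matrix (Fin ℓ) (Fin m) DegBound) (D : Matrix (Fin ℓ) (Fin n) DegBound)
    (M : Fin m → ℕ) (N : Fin n → ℕ) : Prop :=
  ∃ (p : U → Fin m) (q : V → Fin n), G.IsBiregularWitness C D p q ∧
    (∀ j : Fin m, {u : U | p u = j}.ncard = M j) ∧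
    (∀ k : Fin n, {v : V | q v = k}.ncard = N k)

end TypedBipartiteGraph

/-! Semilinear sets are Presburger definable, so it suffices that the sizes of biregular graphs form
a semilinear set. Let `Δ` bound all numbers in `C` and `D`, and call a vertex high for a label if
its degree there exceeds `Δ`. A realization with fewest edges has no edge whose two ends are both
high for its label (`exists_minimal`). Its edges therefore split into a core of degrees at most `Δ`
and further edges, each joining a low vertex to a high one (`exists_isCore`). At a high vertex the
core edges alone meet the constraint, and additional edges do no harm.

Hence a vertex matters only through finitely many local data, its type. Conversely, numbers of
vertices of every type come from a graph as soon as the core degrees balance and every nonempty core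
and every set of high vertices that is needed is large: the core is built by switching edges
(`exists_bipartite_of_degrees`), and the further edges are then attached to high vertices without
collisions (`exists_extension`).

To dispose of small cores and small sets of high vertices, a pigeonhole argument (`exists_gap`)
provides a threshold, bounded in terms of `ℓ` and `Δ`, such that each of these quantities is either
below it or far above it. The vertices involved in the small ones are named. They are boundedly
many, their adjacencies are recorded explicitly, and their removal leaves the large quantities
large. The sizes thus form a finite union, over the configurations of named vertices, of translated
linear images of the semilinear sets cut out by `Certificate`. -/

namespace BiregularGraph

open Finset
open scoped Classical

/-! ### Counting elements with a property -/

section Count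

variable {V ι : Type} [Fintype V] {p q : V → Prop}

/-- The number of elements with a given property. -/
noncomputable def cnt (p : V → Prop) : ℕ :=
  #{v | p v}

theorem cnt_eq_card (p : V → Prop) [DecidablePred p] : cnt p = #{v | p v} := by
  unfold cnt
  congr!

theorem cnt_congr (h : ∀ v, p v ↔ q v) : cnt p = cnt q :=
  congrArg cnt (funext fun v => propext (h v))

theorem cnt_mono (h : ∀ v, p v → q v) : cnt p ≤ cnt q :=
  card_le_card (monotone_filter_right _ fun v _ hv => h v hv)

theorem cnt_lt_cnt (h : ∀ v, p v → q v) {v : V} (hp : ¬ p v) (hq : q v) : cnt p < cnt q := by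
  refine card_lt_card ⟨monotone_filter_right _ fun v _ hv => h v hv, fun hs => hp ?_⟩
  simpa using hs (by simpa using hq : v ∈ ({v | q v} : Finset V))

theorem cnt_eq_zero : cnt p = 0 ↔ ∀ v, ¬ p v := by
  simp [cnt, filter_eq_empty_iff]

theorem cnt_false : cnt (fun _ : V => False) = 0 := by
  simp [cnt]

theorem cnt_or_le : cnt (fun v => p v ∨ q v) ≤ cnt p + cnt q := by
  refine le_trans (le_of_eq ?_) (card_union_le _ _)
  unfold cnt
  congr 1
  ext; simp

theorem cnt_or_of_disjoint (h : ∀ v, p v → ¬ q v) : cnt (fun v => p v ∨ q v) = cnt p + cnt q := by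
  unfold cnt
  rw [← card_union_of_disjoint (disjoint_filter.2 fun v _ => h v)]
  congr 1
  ext; simp

theorem cnt_le_and_not_add : cnt p ≤ cnt (fun v => p v ∧ ¬ q v) + cnt q :=
  (cnt_mono fun v hv => by by_cases h : q v <;> simp [h, hv]).trans cnt_or_le

theorem cnt_exists_le [Fintype ι] (r : ι → V → Prop) :
    cnt (fun v => ∃ i, r i v) ≤ ∑ i, cnt (r i) := by
  unfold cnt
  convert card_biUnion_le (s := univ) (t := fun i => ({v | r i v} : Finset V))
  ext; simp

theorem cnt_eq_sum (p : V → Prop) : cnt p = ∑ v, if p v then 1 else 0 := by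
  simp [cnt]

theorem cnt_eq_of_injective [Fintype ι] {f : ι → V} (hf : Function.Injective f) :
    cnt (fun v => ∃ i, f i = v) = Fintype.card ι := by
  rw [← card_univ, ← card_image_of_injective _ hf]
  unfold cnt
  congr 1
  ext; simp

theorem cnt_eq_ncard (p : V → Prop) : cnt p = {v | p v}.ncard := by
  rw [Set.ncard_eq_toFinset_card', cnt]
  congr 1
  ext; simp

end Count

/-! ### Bipartite graphs with prescribed bounded degrees -/

section Augment

variable {U V : Type}

/-- A bipartite graph avoiding `F` whose degrees are at most `c` and `d`. -/
structure IsPartial (F : U → V → Prop) (c : U → ℕ) (d : V → ℕ) (E : Finset (U × V)) : Prop where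
  avoid : ∀ x ∈ E, ¬ F x.1 x.2
  left : ∀ u, #{x ∈ E | x.1 = u} ≤ c u
  right : ∀ v, #{x ∈ E | x.2 = v} ≤ d v

theorem card_filter_fst [Fintype V] (E : Finset (U × V)) (u : U) :
    #{x ∈ E | x.1 = u} = #{v | (u, v) ∈ E} := by
  symm
  apply card_bij (fun v _ => (u, v))
  · intro v hv; simpa using hv
  · intro a _ b _ h; simpa using h
  · rintro ⟨a, b⟩ h
    simp only [mem_filter] at h
    obtain ⟨h, rfl⟩ := h
    exact ⟨b, by simpa using h, rfl⟩

theorem card_filter_snd [Fintype U] (E : Finset (U × V)) (v : V) :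
    #{x ∈ E | x.2 = v} = #{u | (u, v) ∈ E} := by
  symm
  apply card_bij (fun u _ => (u, v))
  · intro v hv; simpa using hv
  · intro a _ b _ h; simpa using h
  · rintro ⟨a, b⟩ h
    simp only [mem_filter] at h
    obtain ⟨h, rfl⟩ := h
    exact ⟨a, by simpa using h, rfl⟩

theorem IsPartial.insert {F : U → V → Prop} {c : U → ℕ} {d : V → ℕ} {E : Finset (U × V)}
    (hE : IsPartial F c d E) {u : U} {v : V} (hF : ¬ F u v)
    (hu : #{x ∈ E | x.1 = u} < c u) (hv : #{x ∈ E | x.2 = v} < d v) :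
    IsPartial F c d (insert (u, v) E) where
  avoid x hx := by
    rcases mem_insert.1 hx with rfl | hx
    · exact hF
    · exact hE.avoid x hx
  left w := by
    rw [filter_insert]
    split_ifs with h
    · obtain rfl : u = w := h
      exact (card_insert_le _ _).trans hu
    · exact hE.left w
  right w := by
    rw [filter_insert]
    split_ifs with h
    · obtain rfl : v = w := h
      exact (card_insert_le _ _).trans hv
    · exact hE.right w

theorem IsPartial.erase {F : U → V → Prop} {c : U → ℕ} {d : V → ℕ} {E : Finset (U × V)}
    (hE : IsPartial F c d E) (x : U × V) : IsPartial F c d (E.erase x) where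
  avoid y hy := hE.avoid y (mem_of_mem_erase hy)
  left w := (card_le_card (filter_subset_filter _ (erase_subset _ _))).trans (hE.left w)
  right w := (card_le_card (filter_subset_filter _ (erase_subset _ _))).trans (hE.right w)

theorem card_filter_erase_lt {α : Type*} [DecidableEq α] {E : Finset α} {p : α → Prop} {x : α}
    (hx : x ∈ E) (hp : p x) : #{y ∈ E.erase x | p y} < #{y ∈ E | p y} := by
  apply card_lt_card
  refine ⟨filter_subset_filter _ (erase_subset _ _), fun h => ?_⟩
  have := h (mem_filter.2 ⟨hx, hp⟩)
  simp at this

/-- Erasing `(u', v')` frees a place at `u'` and at `v'`; with the spare places at `u` and `v` there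
is room for both new edges. -/
theorem IsPartial.switch {F : U → V → Prop} {c : U → ℕ} {d : V → ℕ} {E : Finset (U × V)}
    (hE : IsPartial F c d E) {u u' : U} {v v' : V} (hx : (u', v') ∈ E)
    (h1 : ¬ F u v') (h2 : ¬ F u' v) (hne : u ≠ u') (hne' : v ≠ v')
    (hu : #{x ∈ E | x.1 = u} < c u) (hv : #{x ∈ E | x.2 = v} < d v) :
    IsPartial F c d (Insert.insert (u, v') (Insert.insert (u', v) (E.erase (u', v')))) := by
  have e1 : #{x ∈ E.erase (u', v') | x.1 = u'} < c u' :=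
    (card_filter_erase_lt (p := fun x => x.1 = u') hx rfl).trans_le (hE.left u')
  have e2 : #{x ∈ E.erase (u', v') | x.2 = v'} < d v' :=
    (card_filter_erase_lt (p := fun x => x.2 = v') hx rfl).trans_le (hE.right v')
  have e3 : #{x ∈ E.erase (u', v') | x.1 = u} < c u :=
    (card_le_card (filter_subset_filter _ (erase_subset _ _))).trans_lt hu
  have e4 : #{x ∈ E.erase (u', v') | x.2 = v} < d v :=
    (card_le_card (filter_subset_filter _ (erase_subset _ _))).trans_lt hv
  refine ((hE.erase (u', v')).insert h2 e1 e4).insert h1 ?_ ?_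
  · rwa [filter_insert, if_neg (by simpa using hne.symm)]
  · rwa [filter_insert, if_neg (by simpa using hne')]

/-- A largest partial graph is complete. Otherwise some `u` and `v` lack edges, and switching with
an edge `(u', v')` for which `(u, v')` and `(u', v)` are both available would enlarge it. At most `D
+ Δ` vertices are unavailable to `u`, and likewise to `v`, which spoils at most `2 * ((D + Δ) * Δ)`
edges; the third multiple in `hbig` pays for the edges still missing. -/
theorem exists_bipartite_of_degrees [Fintype U] [Fintype V] (F : U → V → Prop) (c : U → ℕ) (d : V → ℕ) (Δ D : ℕ)
    (hc : ∀ u, c u ≤ Δ) (hd : ∀ v, d v ≤ Δ)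
    (hFl : ∀ u, cnt (fun v => F u v) ≤ D) (hFr : ∀ v, cnt (fun u => F u v) ≤ D)
    (hsum : ∑ u, c u = ∑ v, d v) (hbig : 3 * ((D + Δ) * Δ) < ∑ u, c u) :
    ∃ E : U → V → Prop, (∀ u v, E u v → ¬ F u v) ∧
      (∀ u, cnt (fun v => E u v) = c u) ∧ (∀ v, cnt (fun u => E u v) = d v) := by
  simp only [cnt] at hFl hFr ⊢
  have hne : ({E | IsPartial F c d E} : Finset (Finset (U × V))).Nonempty :=
    ⟨∅, by simp only [mem_filter, mem_univ, true_and]; constructor <;> simp⟩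
  obtain ⟨E, hE, hmax⟩ := exists_max_image _ card hne
  simp only [mem_filter, mem_univ, true_and] at hE hmax
  have sumL : ∑ u, #{x ∈ E | x.1 = u} = #E :=
    (card_eq_sum_card_fiberwise (fun x _ => mem_univ x.1)).symm
  have sumR : ∑ v, #{x ∈ E | x.2 = v} = #E :=
    (card_eq_sum_card_fiberwise (fun x _ => mem_univ x.2)).symm
  suffices h : #E = ∑ u, c u by
    refine ⟨fun u v => (u, v) ∈ E, fun u v h => hE.avoid _ h, fun u => ?_, fun v => ?_⟩
    · have := (sum_eq_sum_iff_of_le fun u _ => hE.left u).1 (sumL.trans h) u (mem_univ u)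
      simpa only [card_filter_fst] using this
    · have := (sum_eq_sum_iff_of_le fun u _ => hE.right u).1
        (sumR.trans (h.trans hsum)) v (mem_univ v)
      simpa only [card_filter_snd] using this
  by_contra hcon
  have hlt : #E < ∑ u, c u :=
    lt_of_le_of_ne (sumL ▸ sum_le_sum fun u _ => hE.left u) hcon
  obtain ⟨u, -, hu⟩ := exists_lt_of_sum_lt (sumL.trans_lt hlt)
  obtain ⟨v, -, hv⟩ := exists_lt_of_sum_lt (sumR.trans_lt (hlt.trans_eq hsum))
  have hadj : ∀ w, #{x ∈ E | x.2 = w} < d w → F u w ∨ (u, w) ∈ E := by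
    intro w hw
    by_contra h
    push Not at h
    have := hmax _ (hE.insert h.1 hu hw)
    rw [card_insert_of_notMem h.2] at this
    omega
  have hNu : #{w | F u w ∨ (u, w) ∈ E} ≤ D + Δ := by
    rw [filter_or]
    refine (card_union_le _ _).trans (add_le_add (hFl u) ?_)
    rw [← card_filter_fst]
    exact (hE.left u).trans (hc u)
  have hNv : #{w | F w v ∨ (w, v) ∈ E} ≤ D + Δ := by
    rw [filter_or]
    refine (card_union_le _ _).trans (add_le_add (hFr v) ?_)
    rw [← card_filter_snd]
    exact (hE.right v).trans (hd v)
  -- By `hadj`, every right vertex that lacks edges is unavailable to `u`, so at most `D + Δ` of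
  -- them do, each lacking at most `Δ`.
  have hElarge : 2 * ((D + Δ) * Δ) < #E := by
    have : ∑ w, d w ≤ #E + (D + Δ) * Δ := by
      calc ∑ w, d w ≤ ∑ w, (#{x ∈ E | x.2 = w} + if F u w ∨ (u, w) ∈ E then Δ else 0) := by
            apply sum_le_sum
            intro w _
            split_ifs with h
            · exact (hd w).trans (Nat.le_add_left _ _)
            · exact not_lt.1 fun hw => h (hadj w hw)
        _ = #E + #{w | F u w ∨ (u, w) ∈ E} * Δ := by
            rw [sum_add_distrib, sumR, ← sum_filter, sum_const, smul_eq_mul]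
        _ ≤ _ := by gcongr
    omega
  have hbadu : #{x ∈ E | F u x.2 ∨ (u, x.2) ∈ E} ≤ (D + Δ) * Δ := by
    calc _ ≤ #(({w | F u w ∨ (u, w) ∈ E} : Finset V).biUnion fun w => {x ∈ E | x.2 = w}) := by
          apply card_le_card
          intro x hx
          simpa [and_comm] using hx
      _ ≤ #{w | F u w ∨ (u, w) ∈ E} * Δ :=
          card_biUnion_le_card_mul _ _ _ fun w _ => (hE.right w).trans (hd w)
      _ ≤ _ := by gcongr
  have hbadv : #{x ∈ E | F x.1 v ∨ (x.1, v) ∈ E} ≤ (D + Δ) * Δ := by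
    calc _ ≤ #(({w | F w v ∨ (w, v) ∈ E} : Finset U).biUnion fun w => {x ∈ E | x.1 = w}) := by
          apply card_le_card
          intro x hx
          simpa [and_comm] using hx
      _ ≤ #{w | F w v ∨ (w, v) ∈ E} * Δ :=
          card_biUnion_le_card_mul _ _ _ fun w _ => (hE.left w).trans (hc w)
      _ ≤ _ := by gcongr
  obtain ⟨⟨u', v'⟩, hx, hgood⟩ : ∃ x ∈ E, ¬ ((F u x.2 ∨ (u, x.2) ∈ E) ∨
      (F x.1 v ∨ (x.1, v) ∈ E)) := by
    by_contra! h
    have : #E ≤ (D + Δ) * Δ + (D + Δ) * Δ := by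
      calc #E ≤ #({x ∈ E | F u x.2 ∨ (u, x.2) ∈ E} ∪ {x ∈ E | F x.1 v ∨ (x.1, v) ∈ E}) := by
            apply card_le_card
            intro x hx
            rw [← filter_or]
            exact mem_filter.2 ⟨hx, h x hx⟩
        _ ≤ _ := (card_union_le _ _).trans (add_le_add hbadu hbadv)
    omega
  push Not at hgood
  obtain ⟨⟨g1, g2⟩, g3, g4⟩ := hgood
  -- The pair `(u, v)` is unavailable, unlike `(u, v')` and `(u', v)`, so the endpoints differ.
  have huv := hadj v hv
  have hne : u ≠ u' := by rintro rfl; tauto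
  have hne' : v ≠ v' := by rintro rfl; tauto
  have := hmax _ (hE.switch hx g1 g3 hne hne' hu hv)
  rw [card_insert_of_notMem, card_insert_of_notMem, card_erase_of_mem hx] at this
  · have := card_pos.2 ⟨_, hx⟩
    omega
  · simp [g4]
  · simp [g2, hne]

end Augment

/-! ### Labelled graphs with exact or lower-bounded degrees -/

section Labelling

variable {ℓ : ℕ} {U V : Type}

/-- The number of edges with label `i` at a left vertex of a labelled bipartite graph. -/
noncomputable def deg [Fintype V] (g : U → V → Option (Fin ℓ)) (i : Fin ℓ) (u : U) : ℕ :=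
  cnt fun v => g u v = some i

theorem exists_labelling (E : Fin ℓ → U → V → Prop)
    (hE : ∀ i j u v, E i u v → E j u v → i = j) :
    ∃ g : U → V → Option (Fin ℓ), ∀ u v i, g u v = some i ↔ E i u v := by
  refine ⟨fun u v => if h : ∃ i, E i u v then some h.choose else none, fun u v i => ?_⟩
  by_cases h : ∃ i, E i u v
  · simp only [h, dite_true, Option.some.injEq]
    refine ⟨fun hi => hi ▸ h.choose_spec, fun hi => hE _ _ _ _ h.choose_spec hi⟩
  · simp only [h, dite_false, reduceCtorEq, false_iff]
    exact fun hi => h ⟨i, hi⟩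

theorem card_ne_none_le [Fintype V] (g : U → V → Option (Fin ℓ)) (u : U) :
    cnt (fun v => g u v ≠ none) ≤ ∑ i, deg g i u :=
  (cnt_mono fun _ hv => Option.ne_none_iff_exists'.1 hv).trans (cnt_exists_le _)

variable [Fintype U] [Fintype V]

/-- Labelled graphs with prescribed bounded degrees exist as soon as every label is either unused
or used often. -/
theorem exists_labelling_of_degrees (c : U → Fin ℓ → ℕ) (d : V → Fin ℓ → ℕ) (Δ : ℕ)
    (hc : ∀ u i, c u i ≤ Δ) (hd : ∀ v i, d v i ≤ Δ)
    (hsum : ∀ i, ∑ u, c u i = ∑ v, d v i)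
    (hbig : ∀ i, ∑ u, c u i = 0 ∨ 3 * ((ℓ * Δ + Δ) * Δ) < ∑ u, c u i) :
    ∃ g : U → V → Option (Fin ℓ),
      (∀ u i, deg g i u = c u i) ∧ ∀ v i, deg (flip g) i v = d v i := by
  suffices h : ∀ s : Finset (Fin ℓ), ∃ g : U → V → Option (Fin ℓ),
      (∀ u i, deg g i u = if i ∈ s then c u i else 0) ∧
      ∀ v i, deg (flip g) i v = if i ∈ s then d v i else 0 by
    simpa using h univ
  intro s
  induction s using Finset.induction_on with
  | empty => exact ⟨fun _ _ => none, by simp [deg, cnt_false], by simp [deg, flip, cnt_false]⟩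
  | insert i s his ih =>
    obtain ⟨g, hg, hg'⟩ := ih
    rcases hbig i with h0 | hb
    · have h0' := (hsum i).symm.trans h0
      simp only [sum_eq_zero_iff, mem_univ, true_implies] at h0 h0'
      refine ⟨g, fun u j => ?_, fun v j => ?_⟩
      · rw [hg]
        rcases eq_or_ne j i with rfl | hj
        · simp [his, h0]
        · simp [hj]
      · rw [hg']
        rcases eq_or_ne j i with rfl | hj
        · simp [his, h0']
        · simp [hj]
    -- The new label must avoid the pairs already labelled, of which every vertex meets at most `ℓ *
    -- Δ`.
    · have hFl : ∀ u, cnt (fun v => g u v ≠ none) ≤ ℓ * Δ := fun u =>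
        (card_ne_none_le g u).trans <| (sum_le_card_nsmul _ _ Δ fun j _ => by
          rw [hg]; split_ifs <;> simp [hc]).trans_eq (by simp)
      have hFr : ∀ v, cnt (fun u => g u v ≠ none) ≤ ℓ * Δ := fun v =>
        (card_ne_none_le (flip g) v).trans <| (sum_le_card_nsmul _ _ Δ fun j _ => by
          rw [hg']; split_ifs <;> simp [hd]).trans_eq (by simp)
      obtain ⟨E, hEF, hEl, hEr⟩ := exists_bipartite_of_degrees (fun u v => g u v ≠ none)
        (fun u => c u i) (fun v => d v i) Δ (ℓ * Δ) (fun u => hc u i) (fun v => hd v i)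
        hFl hFr (hsum i) hb
      have hEF' : ∀ u v, E u v → g u v = none := fun u v h => not_not.1 (hEF u v h)
      have key : ∀ u v j, (if E u v then some i else g u v) = some j ↔
          if j = i then E u v ∨ g u v = some i else g u v = some j := by
        intro u v j
        by_cases hE : E u v
        · simp [hE, hEF' u v hE, eq_comm]
        · by_cases hj : j = i <;> simp [hE, hj]
      refine ⟨fun u v => if E u v then some i else g u v, fun u j => ?_, fun v j => ?_⟩
      · simp only [deg, key]
        rcases eq_or_ne j i with rfl | hj
        · have := hg u j
          simp only [deg, his, if_false, cnt_eq_zero] at this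
          simp [this, hEl]
        · simpa [hj, deg] using hg u j
      · simp only [deg, flip, key]
        rcases eq_or_ne j i with rfl | hj
        · have := hg' v j
          simp only [deg, flip, his, if_false, cnt_eq_zero] at this
          simp [this, hEr]
        · simpa [hj, deg, flip] using hg' v j

omit [Fintype V] in
-- Paint `K` elements of every large `H i` with `true`. At most `ℓ * K` elements are painted
-- altogether, so `K` elements of every large `H i` stay `false`.
theorem exists_colouring (H : Fin ℓ → U → Prop) (K : ℕ) :
    ∃ α : U → Bool, ∀ i, (ℓ + 1) * K ≤ cnt (H i) → ∀ b, K ≤ cnt fun u => H i u ∧ α u = b := by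
  have hex : ∀ i, ∃ P : Finset U, (∀ u ∈ P, H i u) ∧ #P ≤ K ∧
      ((ℓ + 1) * K ≤ cnt (H i) → #P = K) := by
    intro i
    by_cases h : (ℓ + 1) * K ≤ cnt (H i)
    · obtain ⟨P, hP, hc⟩ := exists_subset_card_eq ((Nat.le_mul_of_pos_left K (by simp)).trans h)
      exact ⟨P, fun u hu => by simpa using hP hu, hc.le, fun _ => hc⟩
    · exact ⟨∅, by simp, by simp, fun h' => absurd h' h⟩
  choose P hPH hPle hPeq using hex
  have hcard : ∀ i, cnt (fun u => u ∈ P i) = #(P i) := fun i => by simp [cnt]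
  refine ⟨fun u => decide (∃ i, u ∈ P i), fun i hi b => ?_⟩
  cases b
  · have h1 : cnt (fun u => ∃ i, u ∈ P i) ≤ ℓ * K :=
      (cnt_exists_le _).trans <| (sum_le_card_nsmul _ _ K fun i _ => by
        rw [hcard]; exact hPle i).trans_eq (by simp)
    have h2 : cnt (H i) ≤ _ := cnt_le_and_not_add (q := fun u => ∃ i, u ∈ P i)
    have h3 : (ℓ + 1) * K = ℓ * K + K := by ring
    simp only [decide_eq_false_iff_not]
    omega
  · rw [← hPeq i hi, ← hcard]
    exact cnt_mono fun u hu => ⟨hPH i u hu, by simpa using ⟨i, hu⟩⟩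

omit [Fintype V] in
/-- Every right vertex `v` selects `e v i` neighbours for every label `i`, all distinct. -/
theorem exists_attachment (N : U → V → Prop) (H : U → Fin ℓ → Prop) (e : V → Fin ℓ → ℕ)
    (h : ∀ v i, e v i ≠ 0 → ∑ j, e v j ≤ cnt (fun u => H u i ∧ N u v)) :
    ∃ P : Fin ℓ → U → V → Prop, (∀ i u v, P i u v → H u i ∧ N u v) ∧
      (∀ i j u v, P i u v → P j u v → i = j) ∧ ∀ v i, cnt (fun u => P i u v) = e v i := by
  have hall : ∀ v, ∃ f : (Σ i, Fin (e v i)) → U, Function.Injective f ∧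
      ∀ x, f x ∈ ({u | H u x.1 ∧ N u v} : Finset U) := by
    intro v
    -- Hall's condition is immediate: there are at most `∑ j, e v j` demands, and a single one
    -- already has that many candidates.
    rw [← all_card_le_biUnion_card_iff_exists_injective
      (fun x : Σ i, Fin (e v i) => ({u | H u x.1 ∧ N u v} : Finset U))]
    intro s
    rcases s.eq_empty_or_nonempty with rfl | ⟨x, hx⟩
    · simp
    · calc #s ≤ ∑ j, e v j := (card_le_univ s).trans_eq (by simp)
        _ ≤ cnt (fun u => H u x.1 ∧ N u v) := h v x.1 (Fin.pos x.2).ne'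
        _ = _ := cnt_eq_card _
        _ ≤ _ := card_le_card (subset_biUnion_of_mem
            (fun x : Σ i, Fin (e v i) => ({u | H u x.1 ∧ N u v} : Finset U)) hx)
  choose f hf hfm using hall
  refine ⟨fun i u v => ∃ k, f v ⟨i, k⟩ = u, ?_, ?_, ?_⟩
  · rintro i u v ⟨k, rfl⟩
    simpa using hfm v ⟨i, k⟩
  · rintro i j u v ⟨k, rfl⟩ ⟨k', hk⟩
    exact (congrArg Sigma.fst (hf v hk)).symm
  · intro v i
    refine (cnt_eq_of_injective fun k k' hk => ?_).trans (Fintype.card_fin _)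
    simpa using hf v hk

omit [Fintype U] in
-- `P` consists of the edges requested by `u` itself, `Q` of those requested by the other ends,
-- which are received only under `h`.
theorem deg_of_extension {g₀ g : U → V → Option (Fin ℓ)} {P Q : U → V → Prop} {i : Fin ℓ} {u : U}
    {h : Prop} {e : ℕ} (hg : ∀ v, g u v = some i ↔ g₀ u v = some i ∨ P u v ∨ Q u v)
    (hP : ∀ v, P u v → g₀ u v = none) (hcard : cnt (fun v => P u v) = e) (hQ : ∀ v, Q u v → h) :
    deg g i u = deg g₀ i u + e ∨ h ∧ deg g₀ i u + e ≤ deg g i u := by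
  have hd : cnt (fun v => g₀ u v = some i ∨ P u v) = deg g₀ i u + e := by
    rw [cnt_or_of_disjoint fun v h1 h2 => by simp [hP v h2] at h1, hcard, deg]
  by_cases hh : h
  · refine .inr ⟨hh, ?_⟩
    rw [← hd, deg]
    exact cnt_mono fun v hv => (hg v).2 (by tauto)
  · left
    rw [← hd, deg]
    refine cnt_congr fun v => ?_
    have : ¬ Q u v := fun hq => hh (hQ v hq)
    simp [hg, this]

/-- Requests from the two sides must not claim the same pair with different labels. Both sides are
coloured with two colours; right vertices request only pairs of different colours, left vertices
only pairs of equal colours. -/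
theorem exists_extension (g₀ : U → V → Option (Fin ℓ)) (D : ℕ)
    (e : U → Fin ℓ → ℕ) (e' : V → Fin ℓ → ℕ) (H : U → Fin ℓ → Prop) (H' : V → Fin ℓ → Prop)
    (hg : ∀ u, cnt (fun v => g₀ u v ≠ none) ≤ D) (hg' : ∀ v, cnt (fun u => g₀ u v ≠ none) ≤ D)
    (he : ∀ u, ∑ i, e u i ≤ D) (he' : ∀ v, ∑ i, e' v i ≤ D)
    (hH : ∀ i, (∀ v, e' v i = 0) ∨ (ℓ + 1) * (2 * D) ≤ cnt (fun u => H u i))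
    (hH' : ∀ i, (∀ u, e u i = 0) ∨ (ℓ + 1) * (2 * D) ≤ cnt (fun v => H' v i)) :
    ∃ g : U → V → Option (Fin ℓ),
      (∀ u i, deg g i u = deg g₀ i u + e u i ∨
        H u i ∧ deg g₀ i u + e u i ≤ deg g i u) ∧
      ∀ v i, deg (flip g) i v = deg (flip g₀) i v + e' v i ∨
        H' v i ∧ deg (flip g₀) i v + e' v i ≤ deg (flip g) i v := by
  obtain ⟨α, hα⟩ := exists_colouring (fun i u => H u i) (2 * D)
  obtain ⟨β, hβ⟩ := exists_colouring (fun i v => H' v i) (2 * D)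
  -- Of the `2 * D` candidates of the right colour at most `D` are already joined to `v`, which
  -- leaves enough for a total demand of at most `D`.
  obtain ⟨P, hP, hPu, hPc⟩ := exists_attachment (fun u v => α u ≠ β v ∧ g₀ u v = none) H e' (by
    intro v i hvi
    have h1 := hα i ((hH i).resolve_left fun h => hvi (h v)) (!β v)
    have h2 := cnt_le_and_not_add (p := fun u => H u i ∧ α u = !β v)
      (q := fun u => g₀ u v ≠ none)
    have h3 : cnt (fun u => (H u i ∧ α u = !β v) ∧ ¬ g₀ u v ≠ none) =
        cnt (fun u => H u i ∧ α u ≠ β v ∧ g₀ u v = none) :=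
      cnt_congr fun u => by simp [and_assoc, Bool.eq_not]
    have h4 := he' v
    have h5 := hg' v
    omega)
  obtain ⟨Q, hQ, hQu, hQc⟩ := exists_attachment (fun v u => α u = β v ∧ g₀ u v = none) H' e (by
    intro u i hui
    have h1 := hβ i ((hH' i).resolve_left fun h => hui (h u)) (α u)
    have h2 := cnt_le_and_not_add (p := fun v => H' v i ∧ β v = α u)
      (q := fun v => g₀ u v ≠ none)
    have h3 : cnt (fun v => (H' v i ∧ β v = α u) ∧ ¬ g₀ u v ≠ none) =
        cnt (fun v => H' v i ∧ α u = β v ∧ g₀ u v = none) :=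
      cnt_congr fun v => by simp [and_assoc, eq_comm]
    have h4 := he u
    have h5 := hg u
    omega)
  obtain ⟨g, hgE⟩ := exists_labelling (fun i u v => g₀ u v = some i ∨ Q i v u ∨ P i u v) (by
    intro i j u v hi hj
    rcases hi with hi | hi | hi <;> rcases hj with hj | hj | hj
    · simpa [hi] using hj
    · simp [(hQ _ _ _ hj).2.2] at hi
    · simp [(hP _ _ _ hj).2.2] at hi
    · simp [(hQ _ _ _ hi).2.2] at hj
    · exact hQu _ _ _ _ hi hj
    · exact absurd (hQ _ _ _ hi).2.1 (hP _ _ _ hj).2.1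
    · simp [(hP _ _ _ hi).2.2] at hj
    · exact absurd (hQ _ _ _ hj).2.1 (hP _ _ _ hi).2.1
    · exact hPu _ _ _ _ hi hj)
  refine ⟨g, fun u i => ?_, fun v i => ?_⟩
  · exact deg_of_extension (P := fun u v => Q i v u) (Q := fun u v => P i u v)
      (fun v => hgE u v i) (fun v h => (hQ _ _ _ h).2.2) (hQc u i) fun v h => (hP _ _ _ h).1
  · exact deg_of_extension (g := flip g) (g₀ := flip g₀)
      (P := fun v u => P i u v) (Q := fun v u => Q i v u)
      (fun u => (hgE u v i).trans (or_congr_right or_comm))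
      (fun u h => (hP _ _ _ h).2.2) (hPc v i) fun u h => (hQ _ _ _ h).1

/-- A bound above which a number of edges or vertices is as good as infinite. -/
def largeBound (ℓ Δ : ℕ) : ℕ :=
  3 * ((ℓ * Δ + Δ) * Δ) + 1 + (ℓ + 1) * (2 * (ℓ * Δ))

/-- Labelled graphs in which the degree of `u` in label `i` is `c u i + e u i`, or possibly larger
if `H u i`. The `e`-edges are those whose other endpoint satisfies `H'`. -/
theorem exists_labelling_of_large (c e : U → Fin ℓ → ℕ) (d e' : V → Fin ℓ → ℕ)
    (H : U → Fin ℓ → Prop) (H' : V → Fin ℓ → Prop) (Δ : ℕ)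
    (hc : ∀ u i, c u i ≤ Δ) (hd : ∀ v i, d v i ≤ Δ)
    (he : ∀ u i, e u i ≤ Δ) (he' : ∀ v i, e' v i ≤ Δ)
    (hsum : ∀ i, ∑ u, c u i = ∑ v, d v i)
    (hbig : ∀ i, ∑ u, c u i = 0 ∨ largeBound ℓ Δ ≤ ∑ u, c u i)
    (hH : ∀ i, (∀ v, e' v i = 0) ∨ largeBound ℓ Δ ≤ cnt (fun u => H u i))
    (hH' : ∀ i, (∀ u, e u i = 0) ∨ largeBound ℓ Δ ≤ cnt (fun v => H' v i)) :
    ∃ g : U → V → Option (Fin ℓ),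
      (∀ u i, deg g i u = c u i + e u i ∨ H u i ∧ c u i + e u i ≤ deg g i u) ∧
      ∀ v i, deg (flip g) i v = d v i + e' v i ∨
        H' v i ∧ d v i + e' v i ≤ deg (flip g) i v := by
  -- The first part of `largeBound` serves the switching argument, its last summand the colouring
  -- with `D = ℓ * Δ`.
  unfold largeBound at hbig hH hH'
  obtain ⟨g₀, h1, h2⟩ := exists_labelling_of_degrees c d Δ hc hd hsum
    fun i => (hbig i).imp_right fun h => by omega
  have hs : ∀ f : Fin ℓ → ℕ, (∀ i, f i ≤ Δ) → ∑ i, f i ≤ ℓ * Δ := fun f hf =>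
    (sum_le_card_nsmul _ _ Δ fun i _ => hf i).trans_eq (by simp)
  obtain ⟨g, h3, h4⟩ := exists_extension g₀ (ℓ * Δ) e e' H H'
    (fun u => (card_ne_none_le g₀ u).trans (hs _ fun i => by simp [h1, hc]))
    (fun v => (card_ne_none_le (flip g₀) v).trans (hs _ fun i => by simp [h2, hd]))
    (fun u => hs _ (he u)) (fun v => hs _ (he' v))
    (fun i => (hH i).imp_right fun h => by omega)
    (fun i => (hH' i).imp_right fun h => by omega)
  refine ⟨g, fun u i => ?_, fun v i => ?_⟩
  · simpa only [h1] using h3 u i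
  · simpa only [h2] using h4 v i

end Labelling

/-! ### Translation to labelled graphs -/

section Realizable

variable {ℓ m n : ℕ}

/-- The left sides of a labelled graph satisfy the degree constraints `C`, and the blocks have the
prescribed sizes. -/
structure Satisfies {U V : Type} [Fintype U] [Fintype V] (C : Matrix (Fin ℓ) (Fin m) DegBound)
    (M : Fin m → ℕ) (g : U → V → Option (Fin ℓ)) (p : U → Fin m) : Prop where
  holds : ∀ i u, (C i (p u)).Holds (deg g i u)
  size : ∀ j, cnt (fun u => p u = j) = M j

/-- Biregularity in terms of labelled graphs. -/
def Realizable (C : Matrix (Fin ℓ) (Fin m) DegBound) (D : Matrix (Fin ℓ) (Fin n) DegBound)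
    (M : Fin m → ℕ) (N : Fin n → ℕ) : Prop :=
  ∃ (U V : Type) (_ : Fintype U) (_ : Fintype V) (g : U → V → Option (Fin ℓ))
    (p : U → Fin m) (q : V → Fin n), Satisfies C M g p ∧ Satisfies D N (flip g) q

theorem exists_isBiregularOfSize_iff (C : Matrix (Fin ℓ) (Fin m) DegBound)
    (D : Matrix (Fin ℓ) (Fin n) DegBound) (M : Fin m → ℕ) (N : Fin n → ℕ) :
    (∃ (U V : Type) (_ : Finite U) (_ : Finite V) (G : TypedBipartiteGraph ℓ U V),
      G.IsBiregularOfSize C D M N) ↔ Realizable C D M N := by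
  constructor
  · rintro ⟨U, V, _, _, G, p, q, hG, hM, hN⟩
    have := Fintype.ofFinite U
    have := Fintype.ofFinite V
    obtain ⟨g, hg⟩ := exists_labelling (fun i u v => (u, v) ∈ G.edges i) fun i j u v hi hj => by
      by_contra hij
      exact Set.disjoint_left.1 (G.pairwise_disjoint i j hij) hi hj
    refine ⟨U, V, inferInstance, inferInstance, g, p, q, ⟨fun i u => ?_, fun j => ?_⟩,
      ⟨fun i v => ?_, fun k => ?_⟩⟩
    · simpa only [deg, hg, cnt_eq_ncard, TypedBipartiteGraph.degLeft] using hG.left i u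
    · rw [cnt_eq_ncard, hM]
    · simpa only [deg, flip, hg, cnt_eq_ncard, TypedBipartiteGraph.degRight] using hG.right i v
    · rw [cnt_eq_ncard, hN]
  · rintro ⟨U, V, _, _, g, p, q, hC, hD⟩
    refine ⟨U, V, inferInstance, inferInstance, ⟨fun i => {x | g x.1 x.2 = some i}, ?_⟩, p, q,
      ⟨fun i u => ?_, fun i v => ?_⟩, fun j => ?_, fun k => ?_⟩
    · intro i j hij
      rw [Set.disjoint_left]
      intro x (hi : _ = _) (hj : _ = _)
      exact hij (Option.some.inj (hi.symm.trans hj))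
    · have := hC.holds i u
      rwa [deg, cnt_eq_ncard] at this
    · have := hD.holds i v
      rwa [deg, cnt_eq_ncard] at this
    · rw [← cnt_eq_ncard, hC.size]
    · rw [← cnt_eq_ncard, hD.size]

end Realizable

/-! ### Vertex types and sufficiency of certificates -/

section Certificate

variable {ℓ m n a b Δ : ℕ}

/-- The local data of an unnamed vertex: its block, its adjacency to the `b` named vertices of the
other side, and for every label the number of core edges, the number of further edges towards high
vertices, and whether the vertex is itself high. -/
structure VertexType (ℓ Δ m b : ℕ) where
  block : Fin m
  adj : Fin b → Option (Fin ℓ)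
  core : Fin ℓ → Fin (Δ + 1)
  out : Fin ℓ → Fin (Δ + 1)
  high : Fin ℓ → Bool

noncomputable instance : Fintype (VertexType ℓ Δ m b) :=
  Fintype.ofInjective (fun τ => (τ.block, τ.adj, τ.core, τ.out, τ.high)) <| by
    rintro ⟨⟩ ⟨⟩ h
    simpa using h

/-- The total weight of the elements with a given property. -/
noncomputable def weight {T : Type} [Fintype T] (X : T → ℕ) (p : T → Prop) : ℕ :=
  ∑ τ, if p τ then X τ else 0

/-- Every degree that a vertex of type `τ` may have satisfies the constraints. -/
def VertexType.Valid (C : Matrix (Fin ℓ) (Fin m) DegBound) (τ : VertexType ℓ Δ m b) : Prop :=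
  ∀ i, (C i τ.block).Holds (cnt (fun y => τ.adj y = some i) + (τ.core i + τ.out i)) ∧
    (τ.high i = true → ∀ k, cnt (fun y => τ.adj y = some i) + (τ.core i + τ.out i) ≤ k →
      (C i τ.block).Holds k)

/-- The conditions, on the numbers `X` and `Y` of unnamed vertices of every type, that concern the
left side. -/
structure SideCertificate (C : Matrix (Fin ℓ) (Fin m) DegBound) (left : Fin a → Fin m)
    (A : Fin a → Fin b → Option (Fin ℓ)) (X : VertexType ℓ Δ m b → ℕ)
    (Y : VertexType ℓ Δ n a → ℕ) : Prop where
  valid : ∀ τ, X τ = 0 ∨ τ.Valid C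
  named : ∀ x i, (C i (left x)).Holds
    (cnt (fun y => A x y = some i) + weight Y fun σ => σ.adj x = some i)
  large : ∀ i, (∀ τ, X τ = 0 ∨ (τ.out i : ℕ) = 0) ∨
    largeBound ℓ Δ ≤ weight Y fun σ => σ.high i = true

/-- The number of vertices in block `j`. -/
noncomputable def blockSize (left : Fin a → Fin m) (X : VertexType ℓ Δ m b → ℕ) (j : Fin m) : ℕ :=
  cnt (fun x => left x = j) + weight X fun τ => τ.block = j

/-- The conditions, on the numbers of unnamed vertices of every type, under which a graph exists. -/
structure Certificate (C : Matrix (Fin ℓ) (Fin m) DegBound) (D : Matrix (Fin ℓ) (Fin n) DegBound)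
    (left : Fin a → Fin m) (right : Fin b → Fin n) (A : Fin a → Fin b → Option (Fin ℓ))
    (X : VertexType ℓ Δ m b → ℕ) (Y : VertexType ℓ Δ n a → ℕ) : Prop where
  left : SideCertificate C left A X Y
  right : SideCertificate D right (flip A) Y X
  balance : ∀ i, ∑ τ, X τ * (τ.core i : ℕ) = ∑ σ, Y σ * (σ.core i : ℕ)
  core : ∀ i, ∑ τ, X τ * (τ.core i : ℕ) = 0 ∨ largeBound ℓ Δ ≤ ∑ τ, X τ * (τ.core i : ℕ)

/-- The vertices with given numbers of every type. -/
abbrev Vertices (X : VertexType ℓ Δ m b → ℕ) : Type := Σ τ, Fin (X τ)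

/-- The labelled graph on named and unnamed vertices. -/
def glue {X : VertexType ℓ Δ m b → ℕ} {Y : VertexType ℓ Δ n a → ℕ}
    (A : Fin a → Fin b → Option (Fin ℓ)) (g : Vertices X → Vertices Y → Option (Fin ℓ)) :
    Fin a ⊕ Vertices X → Fin b ⊕ Vertices Y → Option (Fin ℓ)
  | .inl x, .inl y => A x y
  | .inl x, .inr v => v.1.adj x
  | .inr u, .inl y => u.1.adj y
  | .inr u, .inr v => g u v

theorem flip_glue {X : VertexType ℓ Δ m b → ℕ} {Y : VertexType ℓ Δ n a → ℕ}
    (A : Fin a → Fin b → Option (Fin ℓ)) (g : Vertices X → Vertices Y → Option (Fin ℓ)) :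
    flip (glue A g) = glue (flip A) (flip g) := by
  ext v u
  cases u <;> cases v <;> rfl

theorem cnt_sum {α β : Type} [Fintype α] [Fintype β] (p : α ⊕ β → Prop) :
    cnt p = cnt (fun x => p (.inl x)) + cnt (fun y => p (.inr y)) := by
  simp only [cnt_eq_sum, Fintype.sum_sum_type]

theorem cnt_vertices (X : VertexType ℓ Δ m b → ℕ) (p : VertexType ℓ Δ m b → Prop) :
    cnt (fun u : Vertices X => p u.1) = weight X p := by
  rw [cnt_eq_sum, Fintype.sum_sigma, weight]
  refine sum_congr rfl fun τ _ => ?_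
  split_ifs <;> simp

theorem sum_vertices (X : VertexType ℓ Δ m b → ℕ) (f : VertexType ℓ Δ m b → ℕ) :
    ∑ u : Vertices X, f u.1 = ∑ τ, X τ * f τ := by
  simp [Fintype.sum_sigma]

theorem SideCertificate.satisfies {C : Matrix (Fin ℓ) (Fin m) DegBound} {left : Fin a → Fin m}
    {A : Fin a → Fin b → Option (Fin ℓ)} {X : VertexType ℓ Δ m b → ℕ}
    {Y : VertexType ℓ Δ n a → ℕ} (h : SideCertificate C left A X Y)
    {g : Vertices X → Vertices Y → Option (Fin ℓ)}
    (hg : ∀ u i, deg g i u = u.1.core i + u.1.out i ∨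
      u.1.high i = true ∧ u.1.core i + u.1.out i ≤ deg g i u) :
    Satisfies C (blockSize left X) (glue A g) (Sum.elim left fun u => u.1.block) where
  holds i u := by
    rcases u with x | u
    · have hdeg : deg (glue A g) i (.inl x) =
          cnt (fun y => A x y = some i) + cnt (fun v : Vertices Y => v.1.adj x = some i) :=
        cnt_sum _
      rw [hdeg, cnt_vertices Y fun σ => σ.adj x = some i]
      exact h.named x i
    · have hdeg : deg (glue A g) i (.inr u) = cnt (fun y => u.1.adj y = some i) + deg g i u :=
        cnt_sum _
      have hv := ((h.valid u.1).resolve_left (Fin.pos u.2).ne') i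
      rw [hdeg]
      rcases hg u i with h1 | ⟨h1, h2⟩
      · rw [h1]
        exact hv.1
      · exact hv.2 h1 _ (Nat.add_le_add_left h2 _)
  size j := by
    rw [cnt_sum, blockSize, ← cnt_vertices X fun τ => τ.block = j]
    rfl

/-- All edges at named vertices are dictated by `A` and `adj`; only the graph between unnamed
vertices has to be built, and `exists_labelling_of_large` supplies it. -/
theorem Certificate.realizable {C : Matrix (Fin ℓ) (Fin m) DegBound}
    {D : Matrix (Fin ℓ) (Fin n) DegBound} {left : Fin a → Fin m} {right : Fin b → Fin n}
    {A : Fin a → Fin b → Option (Fin ℓ)} {X : VertexType ℓ Δ m b → ℕ}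
    {Y : VertexType ℓ Δ n a → ℕ} (h : Certificate C D left right A X Y) :
    Realizable C D (blockSize left X) (blockSize right Y) := by
  obtain ⟨g, h1, h2⟩ := exists_labelling_of_large
    (fun (u : Vertices X) i => (u.1.core i : ℕ)) (fun u i => (u.1.out i : ℕ))
    (fun (v : Vertices Y) i => (v.1.core i : ℕ)) (fun v i => (v.1.out i : ℕ))
    (fun u i => u.1.high i = true) (fun v i => v.1.high i = true) Δ
    (fun u i => Fin.is_le _) (fun u i => Fin.is_le _) (fun u i => Fin.is_le _)
    (fun u i => Fin.is_le _)
    (fun i => by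
      rw [sum_vertices X fun τ => (τ.core i : ℕ), sum_vertices Y fun σ => (σ.core i : ℕ)]
      exact h.balance i)
    (fun i => by
      rw [sum_vertices X fun τ => (τ.core i : ℕ)]
      exact h.core i)
    (fun i => by
      rw [cnt_vertices X fun τ => τ.high i = true]
      rcases h.right.large i with h | h
      · exact .inl fun v => (h v.1).resolve_left (Fin.pos v.2).ne'
      · exact .inr h)
    (fun i => by
      rw [cnt_vertices Y fun τ => τ.high i = true]
      rcases h.left.large i with h | h
      · exact .inl fun v => (h v.1).resolve_left (Fin.pos v.2).ne'
      · exact .inr h)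
  refine ⟨_, _, inferInstance, inferInstance, glue A g, _,
    Sum.elim right fun v => v.1.block, h.left.satisfies h1, ?_⟩
  rw [flip_glue]
  exact h.right.satisfies h2

end Certificate

/-! ### Realizations with fewest edges -/

section Minimal

variable {ℓ m n Δ : ℕ} {U V : Type} [Fintype U] [Fintype V]

/-- The number from which on a constraint is satisfied by all degrees or by none. -/
def bound : DegBound → ℕ
  | .exactly d => d
  | .atLeast d => d

/-- A number above the bound can only satisfy a constraint of the form `atLeast`. -/
theorem holds_of_bound_lt {b : DegBound} {k k' : ℕ} (h : b.Holds k) (hk : bound b < k)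
    (hk' : bound b ≤ k') : b.Holds k' := by
  cases b with
  | exactly d => exact absurd h hk.ne'
  | atLeast d => exact hk'

/-- Among left degrees only that of `u` in label `i` changes. It exceeds `Δ`, so its constraint is a
lower bound that survives the loss of one edge. -/
theorem Satisfies.erase {C : Matrix (Fin ℓ) (Fin m) DegBound} {M : Fin m → ℕ}
    {g g' : U → V → Option (Fin ℓ)} {p : U → Fin m} (h : Satisfies C M g p)
    (hC : ∀ i j, bound (C i j) ≤ Δ) {u : U} {v : V} {i : Fin ℓ} (hi : g u v = some i)
    (hu : Δ < deg g i u)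
    (hg : ∀ u' v', g' u' v' = if u' = u ∧ v' = v then none else g u' v') :
    Satisfies C M g' p where
  size := h.size
  holds j w := by
    by_cases hw : w = u ∧ j = i
    · obtain ⟨rfl, rfl⟩ := hw
      refine holds_of_bound_lt (h.holds j w) ((hC _ _).trans_lt hu) ((hC _ _).trans ?_)
      have h1 : deg g j w ≤ cnt (fun v' => g w v' = some j ∧ ¬ v' = v) + cnt (fun v' => v' = v) :=
        cnt_le_and_not_add
      have h2 : cnt (fun v' => v' = v) = 1 := by simp [cnt_eq_sum]
      have h3 : deg g' j w = cnt (fun v' => g w v' = some j ∧ ¬ v' = v) :=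
        cnt_congr fun v' => by by_cases hv : v' = v <;> simp [hg, hv]
      omega
    · have : deg g' j w = deg g j w := cnt_congr fun v' => by
        rw [hg]
        split_ifs with h'
        · obtain ⟨rfl, rfl⟩ := h'
          simp only [hi, Option.some.injEq, false_iff]
          exact fun h => hw ⟨rfl, h.symm⟩
        · rfl
      rw [this]
      exact h.holds j w

/-- A realization with as few edges as possible has no edge between two vertices of large degree. -/
theorem exists_minimal {C : Matrix (Fin ℓ) (Fin m) DegBound} {D : Matrix (Fin ℓ) (Fin n) DegBound}
    {M : Fin m → ℕ} {N : Fin n → ℕ} {g : U → V → Option (Fin ℓ)} {p : U → Fin m} {q : V → Fin n}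
    (hC : ∀ i j, bound (C i j) ≤ Δ) (hD : ∀ i j, bound (D i j) ≤ Δ)
    (hp : Satisfies C M g p) (hq : Satisfies D N (flip g) q) :
    ∃ g : U → V → Option (Fin ℓ), Satisfies C M g p ∧ Satisfies D N (flip g) q ∧
      ∀ u v i, g u v = some i → Δ < deg g i u → deg (flip g) i v ≤ Δ := by
  obtain ⟨g, hg, hmin⟩ := exists_min_image
    ({g | Satisfies C M g p ∧ Satisfies D N (flip g) q} : Finset (U → V → Option (Fin ℓ)))
    (fun g => cnt fun x : U × V => g x.1 x.2 ≠ none) ⟨g, by simpa using ⟨hp, hq⟩⟩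
  simp only [mem_filter, mem_univ, true_and] at hg hmin
  refine ⟨g, hg.1, hg.2, fun u v i hi hu => ?_⟩
  by_contra! hv
  set g' : U → V → Option (Fin ℓ) := fun u' v' => if u' = u ∧ v' = v then none else g u' v'
    with hg'
  have := hmin g' ⟨hg.1.erase hC hi hu fun _ _ => rfl,
    hg.2.erase hD (u := v) (v := u) hi hv fun v' u' => by simp [flip, hg', and_comm]⟩
  refine absurd this (not_le.2 (cnt_lt_cnt (v := (u, v)) (fun x hx => ?_) ?_ ?_))
  · contrapose hx
    simp [hg', hx]
  · simp [hg']
  · simp [hi]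

end Minimal

/-! ### The core of a minimal realization -/

section Core

variable {ℓ m n Δ : ℕ} {U V : Type} [Fintype U] [Fintype V]

/-- `core` is a set of edges of bounded degree that contains enough edges at every vertex; the
other edges join a vertex of small degree and one of large degree. -/
structure IsCore (Δ : ℕ) (g : U → V → Option (Fin ℓ)) (core : Fin ℓ → U → V → Prop) : Prop where
  edge : ∀ i u v, core i u v → g u v = some i
  card_le : ∀ i u, cnt (core i u) ≤ Δ
  le_card : ∀ i u, Δ < deg g i u → Δ ≤ cnt (core i u)
  excess : ∀ i u v, g u v = some i → ¬ core i u v →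
    (Δ < deg g i u ∧ deg (flip g) i v ≤ Δ) ∨ (deg g i u ≤ Δ ∧ Δ < deg (flip g) i v)

omit [Fintype U] in
-- A vertex of degree at most `Δ` selects all its edges, any other vertex exactly `Δ` of them.
theorem exists_bounded_choice (Δ : ℕ) (g : U → V → Option (Fin ℓ)) :
    ∃ S : Fin ℓ → U → V → Prop, (∀ i u v, S i u v → g u v = some i) ∧
      (∀ i u, cnt (S i u) ≤ Δ) ∧ (∀ i u, Δ < deg g i u → Δ ≤ cnt (S i u)) ∧
      ∀ i u v, deg g i u ≤ Δ → g u v = some i → S i u v := by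
  have hex : ∀ i u, ∃ S : V → Prop, (∀ v, S v → g u v = some i) ∧ cnt S ≤ Δ ∧
      (Δ < deg g i u → Δ ≤ cnt S) ∧ ∀ v, deg g i u ≤ Δ → g u v = some i → S v := by
    intro i u
    by_cases h : deg g i u ≤ Δ
    · exact ⟨fun v => g u v = some i, fun v => id, h, fun h' => absurd h h'.not_ge, fun v _ => id⟩
    · obtain ⟨S, hS, hc⟩ := exists_subset_card_eq (not_le.1 h).le
      have hc' : cnt (fun v => v ∈ S) = Δ := by rw [← hc]; simp [cnt]
      exact ⟨fun v => v ∈ S, fun v hv => by simpa using hS hv, hc'.le, fun _ => hc'.ge,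
        fun v h' => absurd h' h⟩
  choose S h1 h2 h3 h4 using hex
  exact ⟨S, h1, h2, h3, h4⟩

/-- An edge is core if both ends select it. The neighbours of a high vertex are low by `hmin` and
select everything, so all selections of a high vertex are core; an edge outside the core has a high
end that rejected it. -/
theorem isCore_of_choice {g : U → V → Option (Fin ℓ)} {S : Fin ℓ → U → V → Prop}
    {S' : Fin ℓ → V → U → Prop}
    (hmin : ∀ u v i, g u v = some i → Δ < deg g i u → deg (flip g) i v ≤ Δ)
    (h1 : ∀ i u v, S i u v → g u v = some i) (h2 : ∀ i u, cnt (S i u) ≤ Δ)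
    (h3 : ∀ i u, Δ < deg g i u → Δ ≤ cnt (S i u))
    (h4 : ∀ i u v, deg g i u ≤ Δ → g u v = some i → S i u v)
    (h4' : ∀ i v u, deg (flip g) i v ≤ Δ → g u v = some i → S' i v u) :
    IsCore Δ g fun i u v => S i u v ∧ S' i v u where
  edge i u v h := h1 i u v h.1
  card_le i u := (cnt_mono fun v hv => hv.1).trans (h2 i u)
  le_card i u h := (h3 i u h).trans <| cnt_mono fun v hv =>
    ⟨hv, h4' i v u (hmin u v i (h1 i u v hv) h) (h1 i u v hv)⟩
  excess i u v h hc := by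
    by_cases hu : deg g i u ≤ Δ
    · refine .inr ⟨hu, ?_⟩
      by_contra! hv
      exact hc ⟨h4 i u v hu h, h4' i v u hv h⟩
    · exact .inl ⟨not_le.1 hu, hmin u v i h (not_le.1 hu)⟩

theorem exists_isCore {g : U → V → Option (Fin ℓ)}
    (hmin : ∀ u v i, g u v = some i → Δ < deg g i u → deg (flip g) i v ≤ Δ) :
    ∃ core : Fin ℓ → U → V → Prop, IsCore Δ g core ∧
      IsCore Δ (flip g) fun i v u => core i u v := by
  obtain ⟨S, h1, h2, h3, h4⟩ := exists_bounded_choice Δ g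
  obtain ⟨S', h1', h2', h3', h4'⟩ := exists_bounded_choice Δ (flip g)
  refine ⟨fun i u v => S i u v ∧ S' i v u, isCore_of_choice hmin h1 h2 h3 h4 h4', ?_⟩
  have := isCore_of_choice (g := flip g) (S' := S)
    (fun v u i h hv => not_lt.1 fun hu => hv.not_ge (hmin u v i h hu)) h1' h2' h3' h4' h4
  simpa only [and_comm] using this

end Core

/-! ### Type counts of a given graph -/

section Types

variable {ℓ m n a b Δ : ℕ} {U V : Type} [Fintype U] [Fintype V]

/-- The type of a vertex `u`, where `B` is the set of named vertices of the other side, which is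
enumerated by `eB`. -/
noncomputable def vertexType (Δ : ℕ) (g : U → V → Option (Fin ℓ)) (core : Fin ℓ → U → V → Prop)
    (p : U → Fin m) (B : V → Prop) (eB : Fin b → V) (u : U) : VertexType ℓ Δ m b where
  block := p u
  adj y := g u (eB y)
  core i := ⟨min Δ (cnt fun v => ¬ B v ∧ core i u v), Nat.lt_succ_of_le (min_le_left _ _)⟩
  out i := ⟨min Δ (if Δ < deg g i u then 0
    else cnt fun v => ¬ B v ∧ g u v = some i ∧ ¬ core i u v), Nat.lt_succ_of_le (min_le_left _ _)⟩
  high i := decide (Δ < deg g i u)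

omit [Fintype V] in
theorem weight_cnt {T : Type} [Fintype T] (A : U → Prop) (f : U → T) (r : T → Prop) :
    weight (fun τ => cnt fun u => ¬ A u ∧ f u = τ) r = cnt fun u => ¬ A u ∧ r (f u) := by
  have h1 : ∀ τ, (if r τ then cnt (fun u => ¬ A u ∧ f u = τ) else 0) =
      cnt fun u => (¬ A u ∧ r (f u)) ∧ f u = τ := by
    intro τ
    split_ifs with h
    · refine cnt_congr fun u => ?_
      constructor
      · rintro ⟨hu, rfl⟩
        exact ⟨⟨hu, h⟩, rfl⟩
      · exact fun hu => ⟨hu.1.1, hu.2⟩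
    · symm
      rw [cnt_eq_zero]
      rintro u ⟨⟨-, hu⟩, rfl⟩
      exact h hu
  rw [weight, sum_congr rfl fun τ _ => h1 τ]
  simp only [cnt_eq_sum]
  rw [sum_comm]
  refine sum_congr rfl fun u _ => ?_
  by_cases hu : ¬ A u ∧ r (f u)
  · simp [hu]
  · simp only [hu, false_and, if_false, sum_const_zero]

omit [Fintype V] in
theorem sum_cnt_mul {T : Type} [Fintype T] (A : U → Prop) (f : U → T) (r : T → ℕ) :
    ∑ τ, (cnt fun u => ¬ A u ∧ f u = τ) * r τ = ∑ u, if A u then 0 else r (f u) := by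
  simp only [cnt_eq_sum, sum_mul]
  rw [sum_comm]
  refine sum_congr rfl fun u _ => ?_
  by_cases hu : A u <;> simp [hu]

omit [Fintype V] in
theorem cnt_named {A : U → Prop} (e : Fin a ≃ {u // A u}) (P : U → Prop) :
    cnt (fun x => P (e x)) = cnt fun u => A u ∧ P u := by
  unfold cnt
  apply card_bij (fun x _ => (e x : U))
  · intro x hx
    simpa using ⟨(e x).2, by simpa using hx⟩
  · intro x _ y _ h
    exact e.injective (Subtype.ext h)
  · intro u hu
    simp only [mem_filter, mem_univ, true_and] at hu
    exact ⟨e.symm ⟨u, hu.1⟩, by simpa using hu.2, by simp⟩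

omit [Fintype V] in
theorem cnt_and_add_not_and (A P : U → Prop) :
    cnt (fun u => A u ∧ P u) + cnt (fun u => ¬ A u ∧ P u) = cnt P := by
  rw [← cnt_or_of_disjoint fun u h h' => h'.1 h.1]
  exact cnt_congr fun u => by tauto

/-- At a high vertex the `Δ` core edges, whether they lead to named vertices or not, are all
counted, so every number from this count on is allowed. At a low vertex the three counts add up to
its degree. -/
theorem vertexType_valid {C : Matrix (Fin ℓ) (Fin m) DegBound} {M : Fin m → ℕ}
    {g : U → V → Option (Fin ℓ)} {core : Fin ℓ → U → V → Prop} {p : U → Fin m}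
    (hC : ∀ i j, bound (C i j) ≤ Δ) (hp : Satisfies C M g p) (hcore : IsCore Δ g core)
    {B : V → Prop} (eB : Fin b ≃ {v // B v}) (u : U) :
    (vertexType Δ g core p B (fun y => eB y) u).Valid C := by
  intro i
  have hadj : cnt (fun y => g u (eB y) = some i) = cnt fun v => B v ∧ g u v = some i :=
    cnt_named eB fun v => g u v = some i
  have hle : cnt (fun v => ¬ B v ∧ core i u v) ≤ Δ :=
    (cnt_mono fun v hv => hv.2).trans (hcore.card_le i u)
  -- The truncations at `Δ` in `vertexType` never take effect: for the core by `hle`, for the other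
  -- edges of a low vertex by `h2` below.
  simp only [vertexType, hadj, min_eq_right hle, decide_eq_true_eq]
  by_cases hu : Δ < deg g i u
  · have hall : ∀ k, Δ ≤ k → (C i (p u)).Holds k := fun k hk =>
      holds_of_bound_lt (hp.holds i u) ((hC _ _).trans_lt hu) ((hC _ _).trans hk)
    have h1 : Δ ≤ cnt (fun v => B v ∧ g u v = some i) + cnt fun v => ¬ B v ∧ core i u v := by
      refine (hcore.le_card i u hu).trans ((cnt_and_add_not_and B _).symm.trans_le ?_)
      exact Nat.add_le_add_right (cnt_mono fun v hv => ⟨hv.1, hcore.edge i u v hv.2⟩) _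
    simp only [hu, if_true, Nat.min_zero, add_zero, true_implies]
    exact ⟨hall _ h1, fun k hk => hall k (h1.trans hk)⟩
  · have h2 : cnt (fun v => ¬ B v ∧ g u v = some i ∧ ¬ core i u v) ≤ Δ :=
      (cnt_mono fun v hv => hv.2.1).trans (not_lt.1 hu)
    have h3 : cnt (fun v => B v ∧ g u v = some i) + (cnt (fun v => ¬ B v ∧ core i u v) +
        cnt fun v => ¬ B v ∧ g u v = some i ∧ ¬ core i u v) = deg g i u := by
      rw [deg, ← cnt_and_add_not_and B fun v => g u v = some i,
        ← cnt_or_of_disjoint fun v h h' => h'.2.2 h.2]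
      congr 1
      refine cnt_congr fun v => ?_
      have := hcore.edge i u v
      tauto
    simp only [hu, if_false, min_eq_right h2, h3, false_implies, and_true]
    exact hp.holds i u

/-- For `large`: a nonzero `out` yields a non-core edge from a low vertex to an unnamed one, which
must be high, and then `hB` gives many unnamed high vertices. -/
theorem sideCertificate_of_isCore {C : Matrix (Fin ℓ) (Fin m) DegBound} {M : Fin m → ℕ}
    {g : U → V → Option (Fin ℓ)} {core : Fin ℓ → U → V → Prop} {p : U → Fin m} (q : V → Fin n)
    (hC : ∀ i j, bound (C i j) ≤ Δ) (hp : Satisfies C M g p) (hcore : IsCore Δ g core)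
    {A : U → Prop} {B : V → Prop} (eA : Fin a ≃ {u // A u}) (eB : Fin b ≃ {v // B v})
    (hB : ∀ i v, ¬ B v → Δ < deg (flip g) i v →
      largeBound ℓ Δ ≤ cnt fun v => ¬ B v ∧ Δ < deg (flip g) i v) :
    SideCertificate C (fun x => p (eA x)) (fun x y => g (eA x) (eB y))
      (fun τ => cnt fun u => ¬ A u ∧ vertexType Δ g core p B (fun y => eB y) u = τ)
      (fun σ => cnt fun v => ¬ B v ∧
        vertexType Δ (flip g) (fun i v u => core i u v) q A (fun x => eA x) v = σ) where
  valid τ := by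
    rw [or_iff_not_imp_left, cnt_eq_zero]
    intro h
    push Not at h
    obtain ⟨u, -, rfl⟩ := h
    exact vertexType_valid hC hp hcore eB u
  named x i := by
    rw [weight_cnt B _ fun σ : VertexType ℓ Δ n a => σ.adj x = some i,
      cnt_named eB fun v => g (eA x) v = some i]
    have := hp.holds i (eA x)
    rw [deg, ← cnt_and_add_not_and B] at this
    exact this
  large i := by
    rw [or_iff_not_imp_left, weight_cnt B _ fun σ : VertexType ℓ Δ n a => σ.high i = true]
    intro h
    push Not at h
    obtain ⟨τ, h1, h2⟩ := h
    rw [Ne, cnt_eq_zero] at h1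
    push Not at h1
    obtain ⟨u, -, rfl⟩ := h1
    have h3 : ¬ (if Δ < deg g i u then 0
        else cnt fun v => ¬ B v ∧ g u v = some i ∧ ¬ core i u v) = 0 := fun h => h2 (by
      simp [vertexType, h])
    rw [ite_eq_left_iff, Classical.not_imp, cnt_eq_zero] at h3
    push Not at h3
    obtain ⟨hu, v, hv, hg, hc⟩ := h3
    rcases hcore.excess i u v hg hc with ⟨h4, -⟩ | ⟨-, h4⟩
    · exact absurd hu h4.not_ge
    · simpa [vertexType] using hB i v hv h4

theorem blockSize_vertexType {C : Matrix (Fin ℓ) (Fin m) DegBound} {M : Fin m → ℕ}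
    {g : U → V → Option (Fin ℓ)} {core : Fin ℓ → U → V → Prop} {p : U → Fin m}
    (hp : Satisfies C M g p) {A : U → Prop} (B : V → Prop) (eA : Fin a ≃ {u // A u})
    (eB : Fin b → V) :
    blockSize (fun x => p (eA x))
      (fun τ => cnt fun u => ¬ A u ∧ vertexType Δ g core p B eB u = τ) = M := by
  ext j
  rw [blockSize, weight_cnt A _ fun τ : VertexType ℓ Δ m b => τ.block = j,
    cnt_named eA fun u => p u = j, ← hp.size j, ← cnt_and_add_not_and A fun u => p u = j]
  rfl

end Types

/-! ### A pigeonhole argument for thresholds -/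

section Gap

/-- The intervals from `f^[r] 0` (excluded) to `f^[r + 1] 0` (included) are disjoint, and there is
one more of them than there are values `Q x`, so one contains no value. -/
theorem exists_gap {ι : Type} [Fintype ι] (Q : ι → ℕ) (f : ℕ → ℕ) (hf : ∀ t, t ≤ f t) :
    ∃ r ≤ Fintype.card ι, ∀ x, Q x ≤ f^[r] 0 ∨ f (f^[r] 0) < Q x := by
  have hmono : Monotone fun r => f^[r] 0 := fun r s h =>
    Function.monotone_iterate_of_id_le hf h 0
  by_contra! h
  choose x hx using fun r : Fin (Fintype.card ι + 1) => h r (Nat.lt_succ_iff.1 r.2)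
  obtain ⟨r, s, hrs, hxrs⟩ := Fintype.exists_ne_map_eq_of_card_lt x (by simp)
  wlog hlt : r < s generalizing r s
  · exact this s r hrs.symm hxrs.symm (lt_of_le_of_ne (not_lt.1 hlt) hrs.symm)
  have h1 := hmono (Nat.succ_le_of_lt hlt)
  simp only [Nat.succ_eq_add_one, Function.iterate_succ_apply'] at h1
  have h2 := (hx r).2
  have h3 := (hx s).1
  rw [hxrs] at h2
  omega

end Gap

/-! ### Named vertices and necessity of certificates -/

section Named

variable {ℓ m n Δ : ℕ} {U V : Type} [Fintype U] [Fintype V]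

/-- The vertices that are high for a label with few high vertices, or are met by an edge of a small
core. -/
def Named (Δ t : ℕ) (g : U → V → Option (Fin ℓ)) (core : Fin ℓ → U → V → Prop) (u : U) : Prop :=
  ∃ i, (Δ < deg g i u ∧ cnt (fun u => Δ < deg g i u) ≤ t) ∨
    ((∃ v, core i u v) ∧ ∑ u, cnt (core i u) ≤ t)

theorem cnt_exists_le_sum (r : U → V → Prop) : cnt (fun u => ∃ v, r u v) ≤ ∑ u, cnt (r u) := by
  rw [cnt_eq_sum]
  refine sum_le_sum fun u _ => ?_
  split_ifs with h
  · rw [Nat.succ_le_iff, Nat.pos_iff_ne_zero, Ne, cnt_eq_zero]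
    push Not
    exact h
  · exact Nat.zero_le _

/-- Each label contributes at most `t` high vertices and at most `t` endpoints of core edges. -/
theorem cnt_named_le (Δ t : ℕ) (g : U → V → Option (Fin ℓ)) (core : Fin ℓ → U → V → Prop) :
    cnt (Named Δ t g core) ≤ ℓ * (t + t) := by
  have haux : ∀ (P : U → Prop) (c : Prop), (c → cnt P ≤ t) → cnt (fun u => P u ∧ c) ≤ t := by
    intro P c h
    by_cases hc : c
    · simpa [hc] using h hc
    · simp [hc, cnt_false]
  refine (cnt_exists_le _).trans <| (sum_le_card_nsmul _ _ (t + t) fun i _ => ?_).trans_eq (by simp)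
  exact cnt_or_le.trans (add_le_add (haux _ _ id)
    (haux _ _ fun h => (cnt_exists_le_sum _).trans h))

theorem sum_cnt_comm (r : U → V → Prop) :
    ∑ u, cnt (r u) = ∑ v, cnt fun u => r u v := by
  simp only [cnt_eq_sum]
  exact sum_comm

theorem sum_residual (A : U → Prop) (B : V → Prop) (r : U → V → Prop) :
    (∑ u, if A u then 0 else cnt fun v => ¬ B v ∧ r u v) =
      ∑ u, cnt fun v => ¬ A u ∧ ¬ B v ∧ r u v := by
  refine sum_congr rfl fun u _ => ?_
  split_ifs with h <;> simp [h, cnt_false]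

theorem sum_residual_comm (A : U → Prop) (B : V → Prop) (r : U → V → Prop) :
    (∑ u, if A u then 0 else cnt fun v => ¬ B v ∧ r u v) =
      ∑ v, if B v then 0 else cnt fun u => ¬ A u ∧ r u v := by
  rw [sum_residual, sum_residual B A fun v u => r u v, sum_cnt_comm]
  exact sum_congr rfl fun v _ => cnt_congr fun u => by tauto

/-- Each removed vertex takes at most `Δ` edges with it. -/
theorem sum_le_residual (A : U → Prop) (B : V → Prop) (r : U → V → Prop)
    (hr : ∀ u, cnt (r u) ≤ Δ) (hr' : ∀ v, cnt (fun u => r u v) ≤ Δ) :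
    ∑ u, cnt (r u) ≤ (∑ u, if A u then 0 else cnt fun v => ¬ B v ∧ r u v) +
      (cnt A * Δ + cnt B * Δ) := by
  have key : ∀ {U V : Type} [Fintype U] [Fintype V] (A : U → Prop) (r : U → V → Prop),
      (∀ u, cnt (r u) ≤ Δ) → ∑ u, cnt (fun v => A u ∧ r u v) ≤ cnt A * Δ := by
    intro U V _ _ A r h
    rw [cnt_eq_sum, sum_mul]
    refine sum_le_sum fun u _ => ?_
    split_ifs with hu
    · simpa [hu] using h u
    · simp [hu, cnt_false]
  have h1 := key A r hr
  have h2 := key B (fun v u => r u v) hr'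
  rw [sum_cnt_comm] at h2
  calc ∑ u, cnt (r u) ≤ ∑ u, (cnt (fun v => ¬ A u ∧ ¬ B v ∧ r u v) +
        (cnt (fun v => A u ∧ r u v) + cnt fun v => B v ∧ r u v)) := by
        refine sum_le_sum fun u _ => ?_
        refine le_trans ?_ (Nat.add_le_add_left cnt_or_le _)
        refine le_trans ?_ cnt_or_le
        exact cnt_mono fun v hv => by tauto
    _ ≤ _ := by
        rw [sum_add_distrib, sum_add_distrib, sum_residual]
        omega

/-- The number after which a gap of sufficient length ends. -/
def gapEnd (ℓ Δ t : ℕ) : ℕ :=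
  t + (ℓ * (t + t) + (ℓ * (t + t) * Δ + ℓ * (t + t) * Δ)) + largeBound ℓ Δ

/-- An unnamed high vertex shows that its label has more than `t`, hence more than `gapEnd ℓ Δ t`,
high vertices; naming removes at most `ℓ * (t + t)` of them. -/
theorem largeBound_le_high {t : ℕ} {g : U → V → Option (Fin ℓ)} {core : Fin ℓ → U → V → Prop}
    (h : ∀ i, cnt (fun u => Δ < deg g i u) ≤ t ∨ gapEnd ℓ Δ t < cnt (fun u => Δ < deg g i u))
    (i : Fin ℓ) (u : U) (hu : ¬ Named Δ t g core u) (hd : Δ < deg g i u) :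
    largeBound ℓ Δ ≤ cnt fun u => ¬ Named Δ t g core u ∧ Δ < deg g i u := by
  rcases h i with h | h
  · exact absurd ⟨i, .inl ⟨hd, h⟩⟩ hu
  · have h1 := cnt_and_add_not_and (Named Δ t g core) fun u => Δ < deg g i u
    have h2 : cnt (fun u => Named Δ t g core u ∧ Δ < deg g i u) ≤ ℓ * (t + t) :=
      (cnt_mono fun u h => h.1).trans (cnt_named_le Δ t g core)
    unfold gapEnd at h
    omega

/-- A bound for the number of named vertices that suffice. -/
def namedBound (ℓ Δ : ℕ) : ℕ :=
  ℓ * ((gapEnd ℓ Δ)^[3 * ℓ] 0 + (gapEnd ℓ Δ)^[3 * ℓ] 0)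

/-- The certificate is read off from a minimal realization with a core, with names given relative to
a threshold in a gap. -/
theorem Realizable.exists_certificate {C : Matrix (Fin ℓ) (Fin m) DegBound}
    {D : Matrix (Fin ℓ) (Fin n) DegBound} {M : Fin m → ℕ} {N : Fin n → ℕ}
    (hC : ∀ i j, bound (C i j) ≤ Δ) (hD : ∀ i j, bound (D i j) ≤ Δ) (h : Realizable C D M N) :
    ∃ a ≤ namedBound ℓ Δ, ∃ b ≤ namedBound ℓ Δ, ∃ (left : Fin a → Fin m) (right : Fin b → Fin n)
      (A : Fin a → Fin b → Option (Fin ℓ)) (X : VertexType ℓ Δ m b → ℕ)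
      (Y : VertexType ℓ Δ n a → ℕ), Certificate C D left right A X Y ∧
        blockSize left X = M ∧ blockSize right Y = N := by
  obtain ⟨U, V, _, _, g, p, q, hp, hq⟩ := h
  obtain ⟨g, hp, hq, hmin⟩ := exists_minimal hC hD hp hq
  obtain ⟨core, hcore, hcore'⟩ := exists_isCore hmin
  -- Three quantities per label have to avoid the gap, whence the `3 * ℓ` iterations in
  -- `namedBound`.
  obtain ⟨r, hr, hgap⟩ := exists_gap (Sum.elim (fun i => cnt fun u => Δ < deg g i u)
    (Sum.elim (fun i => cnt fun v => Δ < deg (flip g) i v) fun i => ∑ u, cnt (core i u)))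
    (gapEnd ℓ Δ) fun t => by unfold gapEnd; omega
  simp only [Fintype.card_sum, Fintype.card_fin] at hr
  set t := (gapEnd ℓ Δ)^[r] 0
  have ht : t ≤ (gapEnd ℓ Δ)^[3 * ℓ] 0 :=
    Function.monotone_iterate_of_id_le (f := gapEnd ℓ Δ)
      (fun t => by simp only [id, gapEnd]; omega) (by omega : r ≤ 3 * ℓ) 0
  have hg1 := fun i => hgap (.inl i)
  have hg2 := fun i => hgap (.inr (.inl i))
  have hg3 := fun i => hgap (.inr (.inr i))
  simp only [Sum.elim_inl, Sum.elim_inr] at hg1 hg2 hg3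
  set A := Named Δ t g core with hA
  set B := Named Δ t (flip g) (fun i v u => core i u v) with hB
  have hAt : cnt A ≤ ℓ * (t + t) := cnt_named_le _ _ _ _
  have hBt : cnt B ≤ ℓ * (t + t) := cnt_named_le _ _ _ _
  have hbd : ℓ * (t + t) ≤ namedBound ℓ Δ := Nat.mul_le_mul_left _ (add_le_add ht ht)
  have eA : Fin (cnt A) ≃ {u // A u} :=
    (Fintype.equivFinOfCardEq (by rw [Fintype.card_subtype, cnt])).symm
  have eB : Fin (cnt B) ≃ {v // B v} :=
    (Fintype.equivFinOfCardEq (by rw [Fintype.card_subtype, cnt])).symm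
  have hres : ∀ i u, min Δ (cnt fun v => ¬ B v ∧ core i u v) = cnt fun v => ¬ B v ∧ core i u v :=
    fun i u => min_eq_right ((cnt_mono fun v hv => hv.2).trans (hcore.card_le i u))
  have hres' : ∀ i v, min Δ (cnt fun u => ¬ A u ∧ core i u v) = cnt fun u => ¬ A u ∧ core i u v :=
    fun i v => min_eq_right ((cnt_mono fun u hu => hu.2).trans (hcore'.card_le i v))
  have hX : ∀ i, ∑ τ, (cnt fun u => ¬ A u ∧ vertexType Δ g core p B (fun y => eB y) u = τ) *
      (τ.core i : ℕ) = ∑ u, if A u then 0 else cnt fun v => ¬ B v ∧ core i u v := by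
    intro i
    rw [sum_cnt_mul A _ fun τ : VertexType ℓ Δ m (cnt B) => (τ.core i : ℕ)]
    simp only [vertexType, hres]
  have hY : ∀ i, ∑ σ, (cnt fun v => ¬ B v ∧ vertexType Δ (flip g) (fun i v u => core i u v) q A
      (fun x => eA x) v = σ) * (σ.core i : ℕ) =
      ∑ v, if B v then 0 else cnt fun u => ¬ A u ∧ core i u v := by
    intro i
    rw [sum_cnt_mul B _ fun σ : VertexType ℓ Δ n (cnt A) => (σ.core i : ℕ)]
    simp only [vertexType, hres']
  refine ⟨cnt A, hAt.trans hbd, cnt B, hBt.trans hbd, _, _, fun x y => g (eA x) (eB y), _, _,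
    ⟨sideCertificate_of_isCore q hC hp hcore eA eB (largeBound_le_high hg2),
      sideCertificate_of_isCore p hD hq hcore' eB eA (largeBound_le_high hg1), fun i => ?_,
      fun i => ?_⟩,
    blockSize_vertexType hp _ _ _, blockSize_vertexType hq _ _ _⟩
  -- Both sums count the core edges between unnamed vertices.
  · rw [hX, hY, sum_residual_comm]
  · rw [hX]
    rcases hg3 i with h | h
    -- The left ends of a small core are all named, so nothing of it remains.
    · left
      refine sum_eq_zero fun u _ => ?_
      split_ifs with hu
      · rfl
      · exact cnt_eq_zero.2 fun v hv => hu ⟨i, .inr ⟨⟨v, hv.2⟩, h⟩⟩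
    -- The middle summands of `gapEnd` absorb the core edges lost at named vertices.
    · right
      have h1 := sum_le_residual A B (core i) (hcore.card_le i) (hcore'.card_le i)
      have h2 := Nat.mul_le_mul_right Δ hAt
      have h3 := Nat.mul_le_mul_right Δ hBt
      unfold gapEnd at h
      omega

end Named

/-! ### Semilinearity and definability -/

section Semilinear

variable {ℓ m n a b Δ : ℕ}

/-- `weight` as a homomorphism. -/
noncomputable def weightHom {T : Type} [Fintype T] (p : T → Prop) : (T → ℕ) →+ ℕ where
  toFun X := weight X p
  map_zero' := by simp [weight]
  map_add' X Y := by
    simp only [weight, ← sum_add_distrib]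
    exact sum_congr rfl fun τ _ => by split_ifs <;> simp

/-- Weighted sums as homomorphisms. -/
def sumHom {T : Type} [Fintype T] (r : T → ℕ) : (T → ℕ) →+ ℕ where
  toFun X := ∑ τ, X τ * r τ
  map_zero' := by simp
  map_add' X Y := by simp [add_mul, sum_add_distrib]

theorem isSemilinearSet_ge (K : ℕ) : IsSemilinearSet {k : ℕ | K ≤ k} := by
  have h : {k : ℕ | K ≤ k} = {k : ℕ | k < K}ᶜ := by ext; simp
  rw [h]
  exact (IsSemilinearSet.of_finite (Set.finite_lt_nat K)).compl

theorem isSemilinearSet_holds (B : DegBound) (c : ℕ) : IsSemilinearSet {k | B.Holds (c + k)} := by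
  cases B with
  | exactly d =>
    exact .of_finite ((Set.finite_le_nat d).subset fun k (hk : c + k = d) =>
      show k ≤ d by omega)
  | atLeast d =>
    -- Truncated subtraction is right here: if `d ≤ c`, every `k` qualifies.
    convert isSemilinearSet_ge (d - c) using 1
    ext k
    simp only [DegBound.Holds, Set.mem_ofPred_eq]
    omega

theorem isSemilinearSet_eq_zero_or {T : Type} [Fintype T] (τ : T) (P : Prop) :
    IsSemilinearSet {X : T → ℕ | X τ = 0 ∨ P} := by
  by_cases hP : P
  · simp [hP]
  · simp only [hP, or_false]
    exact (IsSemilinearSet.singleton 0).preimage (Pi.evalAddMonoidHom (fun _ : T => ℕ) τ)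

theorem isSemilinearSet_sideCertificate (C : Matrix (Fin ℓ) (Fin m) DegBound)
    (left : Fin a → Fin m) (A : Fin a → Fin b → Option (Fin ℓ)) :
    IsSemilinearSet {z : (VertexType ℓ Δ m b → ℕ) × (VertexType ℓ Δ n a → ℕ) |
      SideCertificate C left A z.1 z.2} := by
  have h : {z : (VertexType ℓ Δ m b → ℕ) × (VertexType ℓ Δ n a → ℕ) |
      SideCertificate C left A z.1 z.2} =
      (⋂ τ, {z | z.1 τ = 0 ∨ τ.Valid C}) ∩
      ((⋂ x, ⋂ i, {z | (C i (left x)).Holds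
        (cnt (fun y => A x y = some i) + weight z.2 fun σ => σ.adj x = some i)}) ∩
      ⋂ i, ((⋂ τ, {z | z.1 τ = 0 ∨ (τ.out i : ℕ) = 0}) ∪
        {z | largeBound ℓ Δ ≤ weight z.2 fun σ => σ.high i = true})) := by
    ext z
    simp only [Set.mem_ofPred_eq, Set.mem_inter_iff, Set.mem_iInter, Set.mem_union]
    exact ⟨fun h => ⟨h.valid, h.named, h.large⟩, fun h => ⟨h.1, h.2.1, h.2.2⟩⟩
  have h1 : ∀ (τ : VertexType ℓ Δ m b) (P : Prop), IsSemilinearSet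
      {z : (VertexType ℓ Δ m b → ℕ) × (VertexType ℓ Δ n a → ℕ) | z.1 τ = 0 ∨ P} := fun τ P =>
    (isSemilinearSet_eq_zero_or τ P).preimage (AddMonoidHom.fst _ _)
  have h2 : ∀ (p : VertexType ℓ Δ n a → Prop) {s : Set ℕ}, IsSemilinearSet s → IsSemilinearSet
      {z : (VertexType ℓ Δ m b → ℕ) × (VertexType ℓ Δ n a → ℕ) | weight z.2 p ∈ s} :=
    fun p s hs => hs.preimage ((weightHom p).comp (AddMonoidHom.snd _ _))
  rw [h]
  refine .inter (.iInter fun τ => h1 _ _) (.inter (.iInter fun x => .iInter fun i => ?_)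
    (.iInter fun i => .union (.iInter fun τ => h1 _ _) ?_))
  · exact h2 _ (isSemilinearSet_holds _ _)
  · exact h2 _ (isSemilinearSet_ge _)

theorem isSemilinearSet_certificate (C : Matrix (Fin ℓ) (Fin m) DegBound)
    (D : Matrix (Fin ℓ) (Fin n) DegBound) (left : Fin a → Fin m) (right : Fin b → Fin n)
    (A : Fin a → Fin b → Option (Fin ℓ)) :
    IsSemilinearSet {z : (VertexType ℓ Δ m b → ℕ) × (VertexType ℓ Δ n a → ℕ) |
      Certificate C D left right A z.1 z.2} := by
  have h : {z : (VertexType ℓ Δ m b → ℕ) × (VertexType ℓ Δ n a → ℕ) |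
      Certificate C D left right A z.1 z.2} =
      {z | SideCertificate C left A z.1 z.2} ∩
      ({z | SideCertificate D right (flip A) z.2 z.1} ∩
      ((⋂ i, {z | ∑ τ, z.1 τ * (τ.core i : ℕ) = ∑ σ, z.2 σ * (σ.core i : ℕ)}) ∩
      ⋂ i, {z | (∑ τ, z.1 τ * (τ.core i : ℕ)) ∈ ({0} ∪ {k | largeBound ℓ Δ ≤ k} : Set ℕ)})) := by
    ext z
    simp only [Set.mem_ofPred_eq, Set.mem_inter_iff, Set.mem_iInter, Set.mem_union,
      Set.mem_singleton_iff]
    exact ⟨fun h => ⟨h.left, h.right, h.balance, h.core⟩, fun h => ⟨h.1, h.2.1, h.2.2.1, h.2.2.2⟩⟩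
  rw [h]
  refine .inter (isSemilinearSet_sideCertificate C left A) (.inter
    ((isSemilinearSet_sideCertificate D right (flip A)).preimage
      (AddEquiv.prodComm (M := VertexType ℓ Δ m b → ℕ) (N := VertexType ℓ Δ n a → ℕ)))
    (.inter (.iInter fun i => ?_) (.iInter fun i => ?_)))
  · have := isSemilinearSet_setOfPred_eq (0 : ℕ) 0
      ((sumHom fun τ : VertexType ℓ Δ m b => (τ.core i : ℕ)).comp
        (AddMonoidHom.fst _ (VertexType ℓ Δ n a → ℕ)))
      ((sumHom fun σ : VertexType ℓ Δ n a => (σ.core i : ℕ)).comp (AddMonoidHom.snd _ _))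
    simp only [zero_add] at this
    exact this
  · exact ((IsSemilinearSet.singleton 0).union (isSemilinearSet_ge _)).preimage
      ((sumHom fun τ : VertexType ℓ Δ m b => (τ.core i : ℕ)).comp
        (AddMonoidHom.fst _ (VertexType ℓ Δ n a → ℕ)))

/-- The block sizes contributed by the unnamed vertices. -/
noncomputable def unnamedSize (ℓ Δ m n a b : ℕ) :
    (VertexType ℓ Δ m b → ℕ) × (VertexType ℓ Δ n a → ℕ) →+ (Fin m ⊕ Fin n → ℕ) where
  toFun z := Sum.elim (fun j => weightHom (fun τ : VertexType ℓ Δ m b => τ.block = j) z.1)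
    fun k => weightHom (fun σ : VertexType ℓ Δ n a => σ.block = k) z.2
  map_zero' := by ext (j | k) <;> simp
  map_add' z z' := by ext (j | k) <;> simp

/-- The unnamed vertices contribute a linear image of the certificates, the named ones a constant
translation. -/
theorem isSemilinearSet_blockSize (C : Matrix (Fin ℓ) (Fin m) DegBound)
    (D : Matrix (Fin ℓ) (Fin n) DegBound) (left : Fin a → Fin m) (right : Fin b → Fin n)
    (A : Fin a → Fin b → Option (Fin ℓ)) :
    IsSemilinearSet {x : Fin m ⊕ Fin n → ℕ | ∃ (X : VertexType ℓ Δ m b → ℕ)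
      (Y : VertexType ℓ Δ n a → ℕ), Certificate C D left right A X Y ∧
        blockSize left X = x ∘ Sum.inl ∧ blockSize right Y = x ∘ Sum.inr} := by
  convert ((isSemilinearSet_certificate C D left right A).image
    (unnamedSize ℓ Δ m n a b)).vadd (Sum.elim (fun j => cnt fun x => left x = j)
      fun k => cnt fun y => right y = k) using 1
  ext x
  simp only [Set.mem_ofPred_eq, Set.mem_vadd_set, Set.mem_image, Prod.exists]
  constructor
  · rintro ⟨X, Y, h, h1, h2⟩
    refine ⟨_, ⟨X, Y, h, rfl⟩, ?_⟩
    ext (j | k)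
    · exact congrFun h1 j
    · exact congrFun h2 k
  · rintro ⟨_, ⟨X, Y, h, rfl⟩, rfl⟩
    exact ⟨X, Y, h, rfl, rfl⟩

/-- Since `namedBound` depends only on `ℓ` and `Δ`, there are finitely many configurations of named
vertices, each giving a semilinear set. -/
theorem isSemilinearSet_realizable (C : Matrix (Fin ℓ) (Fin m) DegBound)
    (D : Matrix (Fin ℓ) (Fin n) DegBound) :
    IsSemilinearSet {x : Fin m ⊕ Fin n → ℕ |
      Realizable C D (x ∘ Sum.inl) (x ∘ Sum.inr)} := by
  obtain ⟨Δ, hC, hD⟩ : ∃ Δ, (∀ i j, bound (C i j) ≤ Δ) ∧ ∀ i j, bound (D i j) ≤ Δ := by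
    refine ⟨(∑ i, ∑ j, bound (C i j)) + ∑ i, ∑ j, bound (D i j), fun i j => ?_, fun i j => ?_⟩
    · refine le_trans ?_ (Nat.le_add_right _ _)
      exact (single_le_sum (f := fun j => bound (C i j)) (by simp) (mem_univ j)).trans
        (single_le_sum (f := fun i => ∑ j, bound (C i j)) (by simp) (mem_univ i))
    · refine le_trans ?_ (Nat.le_add_left _ _)
      exact (single_le_sum (f := fun j => bound (D i j)) (by simp) (mem_univ j)).trans
        (single_le_sum (f := fun i => ∑ j, bound (D i j)) (by simp) (mem_univ i))
  have h : {x : Fin m ⊕ Fin n → ℕ | Realizable C D (x ∘ Sum.inl) (x ∘ Sum.inr)} =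
      ⋃ (a : Fin (namedBound ℓ Δ + 1)) (b : Fin (namedBound ℓ Δ + 1)) (left : Fin a → Fin m)
        (right : Fin b → Fin n) (A : Fin a → Fin b → Option (Fin ℓ)),
        {x : Fin m ⊕ Fin n → ℕ | ∃ (X : VertexType ℓ Δ m b → ℕ) (Y : VertexType ℓ Δ n a → ℕ),
          Certificate C D left right A X Y ∧
          blockSize left X = x ∘ Sum.inl ∧ blockSize right Y = x ∘ Sum.inr} := by
    ext x
    simp only [Set.mem_iUnion, Set.mem_ofPred_eq]
    constructor
    · intro h
      obtain ⟨a, ha, b, hb, h⟩ := h.exists_certificate hC hD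
      exact ⟨⟨a, Nat.lt_succ_of_le ha⟩, ⟨b, Nat.lt_succ_of_le hb⟩, h⟩
    · rintro ⟨a, b, left, right, A, X, Y, h, h1, h2⟩
      rw [← h1, ← h2]
      exact h.realizable
  rw [h]
  exact .iUnion fun a => .iUnion fun b => .iUnion fun left => .iUnion fun right => .iUnion fun A =>
    isSemilinearSet_blockSize C D left right A

end Semilinear

end BiregularGraph

theorem mainTheorem7 (ℓ m n : ℕ)
    (C : Matrix (Fin ℓ) (Fin m) DegBound) (D : Matrix (Fin ℓ) (Fin n) DegBound) :
    ∃ BiREG : FirstOrder.Language.presburger.Formula (Fin m ⊕ Fin n),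
      ∀ (M : Fin m → ℕ) (N : Fin n → ℕ),
        (∃ (U V : Type) (_ : Finite U) (_ : Finite V) (G : TypedBipartiteGraph ℓ U V),
          G.IsBiregularOfSize C D M N) ↔
        BiREG.Realize (Sum.elim M N) := by
  obtain ⟨φ, hφ⟩ := Set.empty_definable_iff.1
    ((BiregularGraph.isSemilinearSet_realizable C D).definable (A := ∅))
  refine ⟨φ, fun M N => ?_⟩
  rw [BiregularGraph.exists_isBiregularOfSize_iff]
  exact Set.ext_iff.1 hφ (Sum.elim M N)
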